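/- All rings are commutative with unit. Let $R$ be a nonzero chain ring, i.e. a nonzero ring whose ideals are totally ordered by inclusion, and let $Z$ be its set of zero-divisors, which is an ideal. For an $R$-module $M$, say that $\mathrm{w.d.}(M)\le n$ if $\mathrm{Tor}^R_{n+1}(M,N)=0$ for every $R$-module $N$; the weak dimension $\mathrm{w.d.}(M)\in\{0,1,2,\dots,\infty\}$ is the least such $n$ ($\infty$ if there is none). The finitistic weak dimension $\mathrm{f.w.d.}(R)$ is the supremum of $\mathrm{w.d.}(M)$ over all $R$-modules $M$ with $\mathrm{w.d.}(M)<\infty$. The ring $R$ is called IF if every injective $R$-module is flat, and semicoherent if $\mathrm{Hom}_R(E,F)$ is isomorphic to a submodule of a flat $R$-module for all injective $R$-modules $E$ and $F$. Then: 1. $\mathrm{f.w.d.}(R)=0$ if $R$ is IF; 2. $\mathrm{f.w.d.}(R)=1$ if $R$ is semicoherent and not IF; 3. $\mathrm{f.w.d.}(R)=2$ if $R$ is not semicoherent; moreover, in this case, an $R$-module $M$ has finite weak dimension if and only if $Z\otimes_R M$ is flat. -/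

import Mathlib

universe u

/-- A commutative ring is a chain ring if its lattice of ideals is totally ordered by inclusion. -/
def IsChainRing (R : Type u) [CommRing R] : Prop :=
  ∀ I J : Ideal R, I ≤ J ∨ J ≤ I

/-- The ideal of zero-divisors of a (nonzero) chain ring. -/
def zeroDivisorIdeal (R : Type u) [CommRing R] [Nontrivial R] (hR : IsChainRing R) : Ideal R where
  carrier := {a | ∃ b : R, b ≠ 0 ∧ a * b = 0}
  zero_mem' := ⟨1, one_ne_zero, zero_mul 1⟩
  add_mem' := by
    rintro a c ⟨b, hb, hab⟩ ⟨d, hd, hcd⟩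
    rcases hR (Ideal.span {b}) (Ideal.span {d}) with h | h
    · obtain ⟨e, rfl⟩ := Ideal.span_singleton_le_span_singleton.1 h
      exact ⟨d * e, hb, by rw [add_mul, hab, ← mul_assoc, hcd, zero_mul, add_zero]⟩
    · obtain ⟨e, rfl⟩ := Ideal.span_singleton_le_span_singleton.1 h
      exact ⟨b * e, hd, by rw [add_mul, hcd, ← mul_assoc, hab, zero_mul, add_zero]⟩
  smul_mem' := by
    rintro r a ⟨b, hb, hab⟩
    exact ⟨b, hb, by rw [smul_eq_mul, mul_assoc, hab, mul_zero]⟩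

/-- A ring is IF if every injective module is flat. -/
def IsIFRing (R : Type u) [CommRing R] : Prop :=
  ∀ (E : Type u) [AddCommGroup E] [Module R E], Module.Injective R E → Module.Flat R E

/-- A ring is semicoherent if `Hom_R(E, F)` embeds in a flat module for all injective
modules `E` and `F`. -/
def IsSemicoherentRing (R : Type u) [CommRing R] : Prop :=
  ∀ (E F : Type u) [AddCommGroup E] [Module R E] [AddCommGroup F] [Module R F],
    Module.Injective R E → Module.Injective R F →
      ∃ (G : Type u) (_ : AddCommGroup G) (_ : Module R G),
        Module.Flat R G ∧ ∃ f : (E →ₗ[R] F) →ₗ[R] G, Function.Injective f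

/-- `w.d.(M) ≤ n`, i.e. `Tor_{n+1}(M, N) = 0` for every module `N`. -/
def HasWeakDimensionLE (R : Type u) [CommRing R] (M : Type u) [AddCommGroup M] [Module R M]
    (n : ℕ) : Prop :=
  ∀ N : ModuleCat.{u} R,
    CategoryTheory.Limits.IsZero
      (((CategoryTheory.Tor (ModuleCat.{u} R) (n + 1)).obj (ModuleCat.of R M)).obj N)

/-- The weak dimension of a module: the least `n` with `w.d.(M) ≤ n`, and `⊤` if there is none. -/
noncomputable def weakDimension (R : Type u) [CommRing R] (M : Type u) [AddCommGroup M]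
    [Module R M] : ℕ∞ :=
  ⨅ (n : ℕ) (_ : HasWeakDimensionLE R M n), (n : ℕ∞)

/-- The finitistic weak dimension of a ring: the supremum of the weak dimensions of the modules
of finite weak dimension. -/
noncomputable def finitisticWeakDimension (R : Type u) [CommRing R] : ℕ∞ :=
  ⨆ (M : ModuleCat.{u} R) (_ : weakDimension R M < ⊤), weakDimension R M

/-!
Let `Z` be the ideal of zero divisors of the chain ring `R` and `Q` its total ring of fractions, a
chain ring with maximal ideal `Z`. Finitely generated ideals of `R` are principal, so `M` is flat if
and only if `r • x = 0` always implies `x ∈ (0 : r) M` (`IsChainRing.flat_iff`). Together with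
dimension shifting for `Tor` (`hasWeakDimensionLE_succ_iff`), this reduces everything to elements.

The three cases are told apart by annihilators. `R` is IF if and only if each ideal `rR` is an
annihilator `(0 : s)` (`IsChainRing.isIFRing_iff`), and `R` is semicoherent if and only if this holds
over `Q` (`IsChainRing.isSemicoherentRing_iff`). Otherwise `Z ≠ 0` and `(0 : r) = (0 : r) Z` for all
`r ≠ 0` (`IsChainRing.fracIdealsAreAnnihilators_or`).

* If `R` is IF, flat submodules of flat modules are pure, so a module of weak dimension at most one
  is flat, and there is no module of positive finite weak dimension.
* If `R` is semicoherent, a submodule of a flat module is flat as soon as its weak dimension is at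
  most one (`IsChainRing.flat_of_exact_of_le_flat`). This applies to the syzygies of modules of weak
  dimension at most two, so finite weak dimensions are at most one. If `R` is not IF, there is a
  regular nonunit `t`, and `R/tR` has weak dimension one.
* If `R` is not semicoherent, `Z` is flat. Flatness of `Z ⊗ M` passes from a syzygy to the module,
  hence holds for all modules of finite weak dimension
  (`IsChainRing.flat_tensor_zeroDivisorIdeal_of_exact`). Conversely, it makes the second syzygy of
  `M` flat (`IsChainRing.flat_of_flat_tensor_zeroDivisorIdeal`). The bound two is attained: the
  injective hull of `R/Z` is flat, while `R/Z` has weak dimension one.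
-/

/-! ### Weak dimension -/

open CategoryTheory MonoidalCategory in
theorem isZero_tor_succ_iff {R : Type u} [CommRing R] (M : Type u) [AddCommGroup M] [Module R M]
    {N : ModuleCat.{u} R} (P : ProjectiveResolution N) (n : ℕ) :
    Limits.IsZero (((Tor (ModuleCat.{u} R) (n + 1)).obj (ModuleCat.of R M)).obj N) ↔
      Function.Exact ((P.complex.d (n + 2) (n + 1)).hom.lTensor M)
        ((P.complex.d (n + 1) n).hom.lTensor M) := by
  rw [Tor_obj, (P.isoLeftDerivedObj _ (n + 1)).isZero_iff]
  refine (HomologicalComplex.exactAt_iff_isZero_homology _ _).symm.trans ?_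
  rw [HomologicalComplex.exactAt_iff' _ (n + 2) (n + 1) n (by simp only [ChainComplex.prev]; rfl)
    (by simp), ShortComplex.ShortExact.moduleCat_exact_iff_function_exact]
  rfl

open CategoryTheory MonoidalCategory in
theorem isZero_tor_succ_of_flat {R : Type u} [CommRing R] (M : Type u) [AddCommGroup M]
    [Module R M] [Module.Flat R M] (N : ModuleCat.{u} R) (n : ℕ) :
    Limits.IsZero (((Tor (ModuleCat.{u} R) (n + 1)).obj (ModuleCat.of R M)).obj N) := by
  have P := (HasProjectiveResolution.out (Z := N)).some
  rw [isZero_tor_succ_iff M P]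
  exact Module.Flat.lTensor_exact M
    ((ShortComplex.ShortExact.moduleCat_exact_iff_function_exact _).1 (P.exact_succ n))

open CategoryTheory MonoidalCategory in
/-- Dimension shifting. Tensoring the sequence with a projective resolution of `N` gives a short exact
sequence of complexes, whose middle term is acyclic in positive degrees. -/
theorem hasWeakDimensionLE_succ_iff {R : Type u} [CommRing R] {K F M : Type u} [AddCommGroup K]
    [Module R K] [AddCommGroup F] [Module R F] [AddCommGroup M] [Module R M] [Module.Flat R F]
    {f : K →ₗ[R] F} {g : F →ₗ[R] M} (hf : Function.Injective f) (hfg : Function.Exact f g)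
    (hg : Function.Surjective g) (n : ℕ) :
    HasWeakDimensionLE R M (n + 1) ↔ HasWeakDimensionLE R K n := by
  refine forall_congr' fun N => ?_
  have P := (HasProjectiveResolution.out (Z := N)).some
  have hF (k : ℕ) := isZero_tor_succ_of_flat F N k
  simp only [Tor_obj, (P.isoLeftDerivedObj _ _).isZero_iff] at hF ⊢
  let α := (tensoringLeft (ModuleCat.{u} R)).map (ModuleCat.ofHom f)
  let β := (tensoringLeft (ModuleCat.{u} R)).map (ModuleCat.ofHom g)
  let S : ShortComplex (ChainComplex (ModuleCat.{u} R) ℕ) :=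
    ShortComplex.mk ((NatTrans.mapHomologicalComplex α _).app P.complex)
      ((NatTrans.mapHomologicalComplex β _).app P.complex) (by
        have : ModuleCat.ofHom f ≫ ModuleCat.ofHom g = 0 := by
          ext x; exact hfg.apply_apply_eq_zero x
        ext i : 1
        exact (MonoidalCategory.comp_whiskerRight _ _ _).symm.trans
          (by rw [this, MonoidalPreadditive.zero_whiskerRight]; rfl))
  have hS : S.ShortExact := by
    refine HomologicalComplex.shortExact_of_degreewise_shortExact _ fun i => ?_
    have : Module.Projective R (P.complex.X i) :=
      (IsProjective.iff_projective _).2 (P.projective i)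
    refine { exact := ?_, mono_f := ?_, epi_g := ?_ }
    · exact (ShortComplex.ShortExact.moduleCat_exact_iff_function_exact _).2
        (Module.Flat.rTensor_exact (P.complex.X i) hfg)
    · exact (ModuleCat.mono_iff_injective _).2
        (Module.Flat.rTensor_preserves_injective_linearMap (M := P.complex.X i) f hf)
    · exact (ModuleCat.epi_iff_surjective _).2 (LinearMap.rTensor_surjective (P.complex.X i) hg)
  exact (hS.δIso (n + 2) (n + 1) (by simp) (hF (n + 1)) (hF n)).isZero_iff

open CategoryTheory in
/-- The vanishing of `Tor₁(M, R/I)` makes `M ⊗ I → M ⊗ R` injective. As `Tor₁` is computed from an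
arbitrary projective resolution of `R/I`, this resolution has to be compared with `I → R → R/I`. -/
theorem flat_of_hasWeakDimensionLE_zero {R : Type u} [CommRing R] {M : Type u} [AddCommGroup M]
    [Module R M] (h : HasWeakDimensionLE R M 0) : Module.Flat R M := by
  rw [Module.Flat.iff_lTensor_injective]
  intro I _
  let N := ModuleCat.of R (R ⧸ I)
  have P := (HasProjectiveResolution.out (Z := N)).some
  have hM := (isZero_tor_succ_iff M P 0).1 (h N)
  let d₁ := (P.complex.d 2 1).hom
  let d₀ := (P.complex.d 1 0).hom
  let π : P.complex.X 0 →ₗ[R] R ⧸ I := (P.π.f 0).hom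
  have h₁ : Function.Exact d₁ d₀ :=
    (ShortComplex.ShortExact.moduleCat_exact_iff_function_exact _).1 (P.exact_succ 0)
  have h₀ : Function.Exact d₀ π :=
    (ShortComplex.ShortExact.moduleCat_exact_iff_function_exact _).1 P.exact₀
  have hπ : Function.Surjective π := (ModuleCat.epi_iff_surjective _).1 inferInstance
  obtain ⟨p, hp⟩ := hπ (Submodule.Quotient.mk 1)
  have : Module.Projective R (P.complex.X 0) :=
    (IsProjective.iff_projective _).2 (P.projective 0)
  obtain ⟨φ, hφ⟩ := Module.projective_lifting_property I.mkQ π I.mkQ_surjective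
  have hφ' (x) : Submodule.Quotient.mk (φ x) = π x := LinearMap.congr_fun hφ x
  -- comparison maps between `0 → I → R → R/I` and `0 → ker π → P₀ → R/I`
  let j : I →ₗ[R] LinearMap.ker π :=
    ((LinearMap.toSpanSingleton R _ p).comp I.subtype).codRestrict _ fun i => by
      have : (Submodule.Quotient.mk (i : R) : R ⧸ I) = 0 :=
        (Submodule.Quotient.mk_eq_zero I).2 i.2
      change π ((i : R) • p) = 0
      rwa [map_smul, hp, ← Submodule.Quotient.mk_smul, smul_eq_mul, mul_one]
  let ψ : LinearMap.ker π →ₗ[R] I := (φ.comp (Submodule.subtype _)).codRestrict _ fun b => by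
    rw [← Submodule.Quotient.mk_eq_zero I]
    exact (hφ' _).trans b.2
  have ht : φ p - 1 ∈ I := by
    rw [← Submodule.Quotient.mk_eq_zero I, Submodule.Quotient.mk_sub, hφ', hp, sub_self]
  let t : I := ⟨φ p - 1, ht⟩
  have hψj : ψ ∘ₗ j = LinearMap.id + LinearMap.toSpanSingleton R I t ∘ₗ I.subtype := by
    ext i
    simp [ψ, j, t]
    ring
  let e : P.complex.X 1 →ₗ[R] LinearMap.ker π := d₀.codRestrict _ h₀.apply_apply_eq_zero
  have he : Function.Surjective e := fun b => by
    obtain ⟨a, ha⟩ := (h₀ b).1 b.2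
    exact ⟨a, Subtype.ext ha⟩
  have hed : e ∘ₗ d₁ = 0 := by
    ext a
    exact h₁.apply_apply_eq_zero a
  rw [injective_iff_map_eq_zero]
  intro ξ hξ
  obtain ⟨η, hη⟩ := LinearMap.lTensor_surjective M he (j.lTensor M ξ)
  have hη₀ : d₀.lTensor M η = 0 := by
    have h₂ : d₀ = Submodule.subtype _ ∘ₗ e := rfl
    have h₃ : Submodule.subtype _ ∘ₗ j = LinearMap.toSpanSingleton R _ p ∘ₗ I.subtype := rfl
    rw [h₂, LinearMap.lTensor_comp_apply, hη, ← LinearMap.lTensor_comp_apply, h₃,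
      LinearMap.lTensor_comp_apply, hξ, map_zero]
  obtain ⟨θ, rfl⟩ := (hM η).1 hη₀
  have hj : j.lTensor M ξ = 0 := by
    rw [← hη]
    change e.lTensor M (d₁.lTensor M θ) = 0
    rw [← LinearMap.lTensor_comp_apply, hed, LinearMap.lTensor_zero, LinearMap.zero_apply]
  have := congr_arg (ψ.lTensor M) hj
  rwa [← LinearMap.lTensor_comp_apply, hψj, LinearMap.lTensor_add, LinearMap.add_apply,
    LinearMap.lTensor_id, LinearMap.lTensor_comp_apply, hξ, map_zero, map_zero, add_zero] at this

theorem hasWeakDimensionLE_zero_iff {R : Type u} [CommRing R] {M : Type u} [AddCommGroup M]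
    [Module R M] : HasWeakDimensionLE R M 0 ↔ Module.Flat R M :=
  ⟨flat_of_hasWeakDimensionLE_zero, fun _ N => isZero_tor_succ_of_flat M N 0⟩

/-- Every module is the quotient of a flat module by some syzygy. -/
theorem exists_flat_presentation (R : Type u) [CommRing R] (M : Type u) [AddCommGroup M]
    [Module R M] : ∃ (F : Type u) (_ : AddCommGroup F) (_ : Module R F) (_ : Module.Flat R F)
      (K : Submodule R F) (g : F →ₗ[R] M),
      Function.Exact K.subtype g ∧ Function.Surjective g := by
  refine ⟨M →₀ R, inferInstance, inferInstance, inferInstance,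
    LinearMap.ker (Finsupp.linearCombination R (id : M → M)),
    Finsupp.linearCombination R (id : M → M), ?_, Finsupp.linearCombination_id_surjective R M⟩
  exact LinearMap.exact_subtype_ker_map _

theorem HasWeakDimensionLE.succ {R : Type u} [CommRing R] {n : ℕ} :
    ∀ {M : Type u} [AddCommGroup M] [Module R M], HasWeakDimensionLE R M n →
      HasWeakDimensionLE R M (n + 1) := by
  induction n with
  | zero =>
    intro M _ _ h N
    have := hasWeakDimensionLE_zero_iff.1 h
    exact isZero_tor_succ_of_flat M N 1
  | succ n ih =>
    intro M _ _ h
    obtain ⟨F, _, _, _, K, g, hg, hg'⟩ := exists_flat_presentation R M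
    rw [hasWeakDimensionLE_succ_iff K.injective_subtype hg hg'] at h ⊢
    exact ih h

theorem HasWeakDimensionLE.mono {R : Type u} [CommRing R] {M : Type u} [AddCommGroup M]
    [Module R M] {m n : ℕ} (h : HasWeakDimensionLE R M m) (hmn : m ≤ n) :
    HasWeakDimensionLE R M n := by
  induction hmn with
  | refl => exact h
  | step _ ih => exact ih.succ

theorem weakDimension_le_iff {R : Type u} [CommRing R] {M : Type u} [AddCommGroup M]
    [Module R M] {n : ℕ} : weakDimension R M ≤ n ↔ HasWeakDimensionLE R M n := by
  refine ⟨fun h => ?_, fun h => iInf₂_le n h⟩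
  have h' : weakDimension R M < ((n + 1 : ℕ) : ℕ∞) :=
    h.trans_lt (by exact_mod_cast n.lt_succ_self)
  obtain ⟨m, hm⟩ := iInf_lt_iff.1 h'
  obtain ⟨hm, hmn⟩ := iInf_lt_iff.1 hm
  exact hm.mono (Nat.lt_succ_iff.1 (by exact_mod_cast hmn))

theorem weakDimension_lt_top_iff {R : Type u} [CommRing R] {M : Type u} [AddCommGroup M]
    [Module R M] : weakDimension R M < ⊤ ↔ ∃ n, HasWeakDimensionLE R M n := by
  refine ⟨fun h => ?_, fun ⟨n, hn⟩ =>
    (weakDimension_le_iff.2 hn).trans_lt (ENat.natCast_lt_top n)⟩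
  obtain ⟨n, hn⟩ := iInf_lt_iff.1 h
  exact ⟨n, (iInf_lt_iff.1 hn).1⟩

/-- A uniform bound for the modules of finite weak dimension bounds the finitistic dimension. -/
theorem finitisticWeakDimension_le {R : Type u} [CommRing R] {d : ℕ}
    (h : ∀ (M : Type u) [AddCommGroup M] [Module R M] (n : ℕ), HasWeakDimensionLE R M n →
      HasWeakDimensionLE R M d) : finitisticWeakDimension R ≤ d := by
  refine iSup₂_le fun M hM => ?_
  obtain ⟨n, hn⟩ := weakDimension_lt_top_iff.1 hM
  exact weakDimension_le_iff.2 (h M n hn)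

/-- A module of weak dimension exactly `d + 1` bounds the finitistic dimension from below. -/
theorem le_finitisticWeakDimension {R : Type u} [CommRing R] {M : Type u} [AddCommGroup M]
    [Module R M] {d : ℕ} (h : HasWeakDimensionLE R M (d + 1)) (h' : ¬ HasWeakDimensionLE R M d) :
    ((d + 1 : ℕ) : ℕ∞) ≤ finitisticWeakDimension R := by
  refine le_trans ?_ (le_iSup₂_of_le (ModuleCat.of R M)
    (weakDimension_lt_top_iff.2 ⟨_, h⟩) le_rfl)
  rw [← weakDimension_le_iff, not_le] at h'
  exact_mod_cast Order.add_one_le_of_lt h'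

/-! ### Arithmetic of chain rings -/

namespace IsChainRing

variable {R : Type u} [CommRing R]

theorem dvd_or_dvd (hR : IsChainRing R) (a b : R) : a ∣ b ∨ b ∣ a :=
  (hR (Ideal.span {a}) (Ideal.span {b})).symm.imp Ideal.span_singleton_le_span_singleton.1
    Ideal.span_singleton_le_span_singleton.1

theorem exists_eq_smul_of_mem_smul_top (hR : IsChainRing R) {M : Type*} [AddCommGroup M]
    [Module R M] {I : Ideal R} {x : M} (hx : x ∈ I • (⊤ : Submodule R M)) :
    ∃ a ∈ I, ∃ y : M, x = a • y := by
  induction hx using Submodule.smul_induction_on' with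
  | smul a ha y _ => exact ⟨a, ha, y, rfl⟩
  | add x _ y _ hx hy =>
    obtain ⟨a, ha, x, rfl⟩ := hx
    obtain ⟨b, hb, y, rfl⟩ := hy
    rcases hR.dvd_or_dvd a b with ⟨c, rfl⟩ | ⟨c, rfl⟩
    · exact ⟨a, ha, x + c • y, by rw [smul_add, smul_smul]⟩
    · exact ⟨b, hb, c • x + y, by rw [smul_add, smul_smul]⟩

/-- As `I` is uniserial, all tensors in `I ⊗ M` are pure. -/
theorem exists_eq_tmul (hR : IsChainRing R) {M : Type*} [AddCommGroup M]
    [Module R M] {I : Ideal R} (x : TensorProduct R I M) :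
    ∃ (a : I) (y : M), x = a ⊗ₜ[R] y := by
  have key (a b : I) (h : (a : R) ∣ b) : ∃ c : R, b = c • a := by
    obtain ⟨c, hc⟩ := h
    exact ⟨c, Subtype.ext (by rw [hc, mul_comm]; rfl)⟩
  induction x using TensorProduct.induction_on with
  | zero => exact ⟨0, 0, by simp⟩
  | tmul a y => exact ⟨a, y, rfl⟩
  | add x y hx hy =>
    obtain ⟨a, x, rfl⟩ := hx
    obtain ⟨b, y, rfl⟩ := hy
    rcases hR.dvd_or_dvd (a : R) b with h | h
    · obtain ⟨c, rfl⟩ := key _ _ h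
      exact ⟨a, x + c • y, by rw [TensorProduct.tmul_add, TensorProduct.smul_tmul]⟩
    · obtain ⟨c, rfl⟩ := key _ _ h
      exact ⟨b, c • x + y, by rw [TensorProduct.tmul_add, TensorProduct.smul_tmul]⟩

/-- Finitely generated ideals of a chain ring are principal, so flatness is a condition on single
annihilation relations `r • x = 0`. -/
theorem flat_iff (hR : IsChainRing R) {M : Type*} [AddCommGroup M] [Module R M] :
    Module.Flat R M ↔ ∀ (r : R) (x : M), r • x = 0 → ∃ (s : R) (y : M), r * s = 0 ∧ x = s • y := by
  constructor
  · intro h r x hrx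
    obtain ⟨k, a, y, hy, ha⟩ := Module.Flat.isTrivialRelation_of_sum_smul_eq_zero
      (f := fun _ : Unit => r) (x := fun _ => x) (by simpa using hrx)
    have hx : x ∈ Ideal.torsionOf R R r • (⊤ : Submodule R M) := by
      rw [show x = _ from hy ()]
      refine Submodule.sum_mem _ fun j _ => Submodule.smul_mem_smul ?_ trivial
      have := ha j
      rw [Ideal.mem_torsionOf_iff, smul_eq_mul, mul_comm]
      simpa using this
    obtain ⟨s, hs, z, rfl⟩ := hR.exists_eq_smul_of_mem_smul_top hx
    rw [Ideal.mem_torsionOf_iff, smul_eq_mul, mul_comm] at hs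
    exact ⟨s, z, hs, rfl⟩
  · intro h
    rw [Module.Flat.iff_lift_lsmul_comp_subtype_injective]
    intro I _
    rw [injective_iff_map_eq_zero]
    intro ξ hξ
    obtain ⟨a, x, rfl⟩ := hR.exists_eq_tmul ξ
    obtain ⟨s, y, hs, rfl⟩ := h a x (by simpa using hξ)
    rw [← TensorProduct.smul_tmul, show s • a = 0 from Subtype.ext ((mul_comm _ _).trans hs),
      TensorProduct.zero_tmul]

variable [Nontrivial R]

theorem mem_zeroDivisorIdeal (hR : IsChainRing R) {a : R} :
    a ∈ zeroDivisorIdeal R hR ↔ ∃ b : R, b ≠ 0 ∧ a * b = 0 := Iff.rfl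

theorem notMem_zeroDivisorIdeal (hR : IsChainRing R) {a : R} :
    a ∉ zeroDivisorIdeal R hR ↔ a ∈ nonZeroDivisors R := by
  rw [mem_zeroDivisorIdeal, mem_nonZeroDivisors_iff_left]
  push Not
  exact forall_congr' fun b => ⟨fun h h' => by_contra fun hb => h hb h', fun h hb h' => hb (h h')⟩

theorem mul_notMem (hR : IsChainRing R) {a b : R} (ha : a ∉ zeroDivisorIdeal R hR)
    (hb : b ∉ zeroDivisorIdeal R hR) : a * b ∉ zeroDivisorIdeal R hR := by
  rw [notMem_zeroDivisorIdeal] at *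
  exact mul_mem ha hb

theorem eq_zero_of_mul_eq_zero (hR : IsChainRing R) {q x : R} (hq : q ∉ zeroDivisorIdeal R hR)
    (h : q * x = 0) : x = 0 := by_contra fun hx => hq ⟨x, hx, h⟩

theorem exists_mul_eq_of_notMem (hR : IsChainRing R) {q z : R} (hq : q ∉ zeroDivisorIdeal R hR)
    (hz : z ∈ zeroDivisorIdeal R hR) : ∃ z' ∈ zeroDivisorIdeal R hR, z = q * z' := by
  rcases hR.dvd_or_dvd q z with ⟨c, rfl⟩ | ⟨c, rfl⟩
  · refine ⟨c, by_contra fun hc => hR.mul_notMem hq hc hz, rfl⟩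
  · exact absurd (Ideal.mul_mem_right c _ hz) hq

/-- Multiplying a nonzero element of a chain ring by a zero divisor strictly enlarges its
annihilator. -/
theorem exists_mul_eq_zero_of_mem (hR : IsChainRing R) {z t : R}
    (hz : z ∈ zeroDivisorIdeal R hR) (ht : t ≠ 0) : ∃ w, t * z * w = 0 ∧ t * w ≠ 0 := by
  obtain ⟨w, hw, hzw⟩ := hz
  rcases hR.dvd_or_dvd w t with ⟨v, rfl⟩ | ⟨v, rfl⟩
  · exact ⟨1, by linear_combination v * hzw, by simpa using ht⟩
  · exact ⟨v, by linear_combination hzw, hw⟩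

theorem isSMulRegular_of_flat (hR : IsChainRing R) {M : Type*} [AddCommGroup M] [Module R M]
    [Module.Flat R M] {q : R} (hq : q ∉ zeroDivisorIdeal R hR) : IsSMulRegular M q :=
  Module.Flat.isSMulRegular_of_nonZeroDivisors (hR.notMem_zeroDivisorIdeal.1 hq)

end IsChainRing

/-! ### Three conditions on annihilators -/

/-- `a` is a multiple of `r` in the total ring of fractions of `R`. -/
def FracDvd {R : Type u} [CommRing R] (r a : R) : Prop :=
  ∃ q ∈ nonZeroDivisors R, r ∣ q * a

theorem FracDvd.of_dvd {R : Type u} [CommRing R] {r a : R} (h : r ∣ a) : FracDvd r a :=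
  ⟨1, one_mem _, by simpa using h⟩

theorem FracDvd.mul_eq_zero {R : Type u} [CommRing R] {r s a : R} (h : FracDvd r a)
    (hs : r * s = 0) : a * s = 0 := by
  obtain ⟨q, hq, k, hk⟩ := h
  refine (mem_nonZeroDivisors_iff_left.1 hq) _ ?_
  linear_combination s * hk + k * hs

/-- Every principal ideal is the annihilator of an element. For a chain ring, this is a
characterization of IF rings. -/
def PrincipalIdealsAreAnnihilators (R : Type u) [CommRing R] : Prop :=
  ∀ r : R, ∃ s : R, ∀ a, s * a = 0 ↔ r ∣ a

/-- Every principal ideal of the total ring of fractions `Q` of `R` is the annihilator of an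
element; stated in `R` through the contractions `rQ ∩ R`. For a chain ring, this is a
characterization of semicoherence. -/
def FracIdealsAreAnnihilators (R : Type u) [CommRing R] : Prop :=
  ∀ r : R, ∃ s : R, ∀ a, s * a = 0 ↔ FracDvd r a

/-- The zero-divisor ideal `Z` is nonzero and `(0 : r) = (0 : r) Z` for all `r ≠ 0`. As `Z` is the
maximal ideal of the total ring of fractions `Q`, this means that the annihilators `(0 : r)` with
`0 ≠ r ∈ Z` are not finitely generated over `Q`. -/
def AnnihilatorsAreZDivisible (R : Type u) [CommRing R] [Nontrivial R] (hR : IsChainRing R) :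
    Prop :=
  zeroDivisorIdeal R hR ≠ ⊥ ∧ ∀ r : R, r ≠ 0 → ∀ a, r * a = 0 →
    ∃ b, ∃ c ∈ zeroDivisorIdeal R hR, r * b = 0 ∧ a = b * c

namespace IsChainRing

variable {R : Type u} [CommRing R] [Nontrivial R]

theorem fracDvd_iff (hR : IsChainRing R) {r a : R} :
    FracDvd r a ↔ ∃ q ∉ zeroDivisorIdeal R hR, r ∣ q * a :=
  exists_congr fun _ => and_congr_left' hR.notMem_zeroDivisorIdeal.symm

theorem fracDvd_of_not_dvd_zeroDivisor (hR : IsChainRing R) {r a : R}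
    (h : ∀ c ∈ zeroDivisorIdeal R hR, r ≠ a * c) : FracDvd r a := by
  rw [hR.fracDvd_iff]
  rcases hR.dvd_or_dvd r a with h' | ⟨c, rfl⟩
  · exact ⟨1, fun h => one_ne_zero (α := R) (by obtain ⟨b, hb, hb'⟩ := h; simp_all),
      by simpa using h'⟩
  · exact ⟨c, fun hc => h c hc rfl, by rw [mul_comm]⟩

/-- If `(0 : r) = sQ ∩ R` with `Q` the total ring of fractions, then `(0 : s) = rQ ∩ R`. -/
theorem mul_eq_zero_iff_fracDvd_symm (hR : IsChainRing R) {r s : R} (hr : r ≠ 0)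
    (h : ∀ a, r * a = 0 ↔ FracDvd s a) (a : R) : s * a = 0 ↔ FracDvd r a := by
  have hrs : r * s = 0 := (h s).2 (FracDvd.of_dvd dvd_rfl)
  refine ⟨fun hsa => hR.fracDvd_of_not_dvd_zeroDivisor ?_, fun h => ?_⟩
  · rintro c hc rfl
    obtain ⟨w, hw, hw'⟩ := hR.exists_mul_eq_zero_of_mem hc (left_ne_zero_of_mul hr)
    exact hw' (by rw [mul_comm, ((h w).1 hw).mul_eq_zero hsa]) |>.elim
  · rw [mul_comm]
    exact h.mul_eq_zero hrs

/-- If `(0 : r) ≠ (0 : r) Z` for some `r ≠ 0`, then `(0 : r) = aQ ∩ R` for some `a ≠ 0`. From this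
one pair `(r, a)`, the ideal `tQ ∩ R` is obtained as the annihilator of `a / k` or of `a k`, according
to whether `t = r k` or `r = t k`. -/
theorem fracIdealsAreAnnihilators_or (hR : IsChainRing R) :
    FracIdealsAreAnnihilators R ∨ AnnihilatorsAreZDivisible R hR := by
  rw [or_iff_not_imp_right]
  intro hB t
  have h1 : (1 : R) ∉ zeroDivisorIdeal R hR := by
    rintro ⟨b, hb, hb'⟩
    exact hb (by simpa using hb')
  by_cases ht0 : t = 0
  · subst ht0
    refine ⟨1, fun a => ⟨fun h => FracDvd.of_dvd (by simp_all), fun h => ?_⟩⟩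
    simpa using h.mul_eq_zero (zero_mul 1)
  by_cases htZ : t ∉ zeroDivisorIdeal R hR
  · exact ⟨0, fun a => ⟨fun _ => hR.fracDvd_iff.2 ⟨t, htZ, dvd_mul_right _ _⟩, fun _ => zero_mul a⟩⟩
  rw [not_not] at htZ
  have : ∃ r a : R, r ≠ 0 ∧ a ≠ 0 ∧ ∀ v, r * v = 0 ↔ FracDvd a v := by
    rw [AnnihilatorsAreZDivisible, not_and] at hB
    have hB' := hB fun h => ht0 (by simpa [h] using htZ)
    push Not at hB'
    obtain ⟨r, hr, a, hra, h⟩ := hB'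
    refine ⟨r, a, hr, ?_, fun v => ⟨fun hv => ?_, fun hv => ?_⟩⟩
    · rintro rfl
      exact h 0 0 (zero_mem _) (mul_zero r) (by simp)
    · exact hR.fracDvd_of_not_dvd_zeroDivisor fun c hc => h v c hc hv
    · rw [mul_comm]
      exact hv.mul_eq_zero (by rwa [mul_comm])
  obtain ⟨r, a, hr, ha, h⟩ := this
  have h' := hR.mul_eq_zero_iff_fracDvd_symm hr h
  have hra : r * a = 0 := (h a).2 (FracDvd.of_dvd dvd_rfl)
  rcases hR.dvd_or_dvd r t with ⟨k, rfl⟩ | ⟨k, rfl⟩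
  · -- `t = r k`: the annihilator of `a / k` is `tQ ∩ R`
    rcases hR.dvd_or_dvd a k with ⟨s, rfl⟩ | ⟨s, rfl⟩
    · exact absurd (by linear_combination s * hra) ht0
    refine ⟨s, fun v => ⟨fun hv => ?_, fun hv => ?_⟩⟩
    · rcases hR.dvd_or_dvd k v with ⟨v, rfl⟩ | ⟨c, rfl⟩
      · obtain ⟨q, hq, j, hj⟩ := (h' v).1 (by linear_combination hv)
        exact ⟨q, hq, j, by linear_combination k * hj⟩
      · exact absurd (by linear_combination c * hv) ha
    · rw [mul_comm]
      exact hv.mul_eq_zero (by linear_combination hra)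
  · -- `r = t k`: the annihilator of `a k` is `tQ ∩ R`
    refine ⟨a * k, fun v => ⟨fun hv => ?_, fun hv => ?_⟩⟩
    · obtain ⟨q, hq, j, hj⟩ := hR.fracDvd_iff.1 ((h' (k * v)).1 (by linear_combination hv))
      rcases hR.dvd_or_dvd t (q * v) with hd | ⟨c, hc⟩
      · exact hR.fracDvd_iff.2 ⟨q, hq, hd⟩
      by_cases hcZ : c ∈ zeroDivisorIdeal R hR
      · exfalso
        have hreg : 1 - c * j ∉ zeroDivisorIdeal R hR := fun h =>
          h1 (by simpa using add_mem h (Ideal.mul_mem_right j _ hcZ))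
        have : k * v = 0 := by
          refine hR.eq_zero_of_mul_eq_zero (hR.mul_notMem hq hreg) ?_
          linear_combination hj + j * k * hc
        exact hr (by rw [hc]; linear_combination q * c * this)
      · exact hR.fracDvd_iff.2 ⟨c * q, hR.mul_notMem hcZ hq, 1, by rw [hc]; ring⟩
    · rw [mul_comm]
      exact hv.mul_eq_zero (by linear_combination hra)

end IsChainRing

/-! ### Injective hulls -/

/-- A module embedded in an injective module `E` has an essential extension inside `E` which is a
retract of `E`, hence injective. -/
theorem exists_injective_essential_submodule {R : Type u} [CommRing R] {E : Type u}
    [AddCommGroup E] [Module R E] (hE : Module.Injective R E) (N : Submodule R E) :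
    ∃ F : Submodule R E, N ≤ F ∧ Module.Injective R F ∧
      ∀ x ∈ F, x ≠ 0 → ∃ r : R, r • x ∈ N ∧ r • x ≠ 0 := by
  -- `F` is a maximal essential extension of `N` in `E`
  obtain ⟨F, hNF, hF⟩ := zorn_le_nonempty₀
    {F : Submodule R E | ∀ x ∈ F, x ≠ 0 → ∃ r : R, r • x ∈ N ∧ r • x ≠ 0} (by
      intro c hc hchain y hy
      refine ⟨sSup c, fun x hx => ?_, fun z hz => le_sSup hz⟩
      obtain ⟨F, hF, hxF⟩ := (Submodule.mem_sSup_of_directed ⟨y, hy⟩ hchain.directedOn).1 hx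
      exact hc hF x hxF) N (fun x hx hx0 => ⟨1, by simpa using hx, by simpa using hx0⟩)
  -- `C` is maximal with `F ⊓ C = ⊥`
  obtain ⟨C, -, hC⟩ := zorn_le_nonempty₀ {C : Submodule R E | Disjoint F C} (by
      intro c hc hchain y hy
      refine ⟨sSup c, ?_, fun z hz => le_sSup hz⟩
      rw [Set.mem_ofPred_eq, hchain.directedOn.disjoint_sSup_right]
      exact fun _ h => hc h) ⊥ disjoint_bot_right
  have hFC : Disjoint F C := hC.prop
  -- every nonzero element of `E ⧸ C` has a nonzero multiple in the image of `F`
  have hess : ∀ y : E ⧸ C, y ≠ 0 → ∃ r : R, ∃ f ∈ F, f ≠ 0 ∧ r • y = C.mkQ f := by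
    intro y hy
    obtain ⟨e, rfl⟩ := C.mkQ_surjective y
    have he : e ∉ C := fun h => hy ((Submodule.Quotient.mk_eq_zero C).2 h)
    have hlt : ¬ Disjoint F (C ⊔ R ∙ e) := fun h =>
      he (hC.le_of_ge h le_sup_left (Submodule.mem_sup_right (Submodule.mem_span_singleton_self e)))
    rw [Submodule.disjoint_def] at hlt
    push Not at hlt
    obtain ⟨f, hf, hf', hf0⟩ := hlt
    obtain ⟨c, hc, d, hd, rfl⟩ := Submodule.mem_sup.1 hf'
    obtain ⟨r, rfl⟩ := Submodule.mem_span_singleton.1 hd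
    refine ⟨r, _, hf, hf0, ?_⟩
    have hc0 : C.mkQ c = 0 := (Submodule.Quotient.mk_eq_zero C).2 hc
    rw [map_add, map_smul, hc0, zero_add]
  have hinj : Function.Injective (C.mkQ ∘ₗ F.subtype) := by
    rw [injective_iff_map_eq_zero]
    intro x hx
    exact Subtype.ext (Submodule.disjoint_def.1 hFC x x.2
      ((Submodule.Quotient.mk_eq_zero C).1 hx))
  obtain ⟨g, hg⟩ := hE.out _ hinj F.subtype
  have hg' : ∀ f ∈ F, g (C.mkQ f) = f := fun f hf => hg ⟨f, hf⟩
  have hrange : LinearMap.range g ≤ F := by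
    refine hF.le_of_ge ?_ fun x hx => ⟨_, hg' x hx⟩
    rintro _ ⟨y, rfl⟩ hy
    obtain ⟨r, f, hf, hf0, hrf⟩ := hess y (by rintro rfl; simp at hy)
    obtain ⟨s, hs, hs0⟩ := hF.prop f hf hf0
    have : (s * r) • g y = s • f := by rw [mul_smul, ← map_smul, hrf, hg' f hf]
    exact ⟨s * r, this ▸ hs, this ▸ hs0⟩
  refine ⟨F, hNF, ⟨fun X Y _ _ _ _ f hf h => ?_⟩, hF.prop⟩
  obtain ⟨k, hk⟩ := hE.out f hf (F.subtype ∘ₗ h)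
  refine ⟨(g ∘ₗ C.mkQ).codRestrict F (fun e => hrange ⟨_, rfl⟩) ∘ₗ k, fun x => Subtype.ext ?_⟩
  exact (congr_arg (fun e => g (C.mkQ e)) (hk x)).trans (hg' _ (h x).2)

theorem exists_injective_extension (R : Type u) [CommRing R] (M : Type u) [AddCommGroup M]
    [Module R M] : ∃ (E : Type u) (_ : AddCommGroup E) (_ : Module R E) (ι : M →ₗ[R] E),
      Module.Injective R E ∧ Function.Injective ι := by
  obtain ⟨⟨J, _, f, _⟩⟩ := CategoryTheory.EnoughInjectives.presentation (ModuleCat.of R M)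
  exact ⟨J, inferInstance, inferInstance, f.hom, Module.injective_module_of_injective_object R J,
    (ModuleCat.mono_iff_injective f).1 inferInstance⟩

/-- Every module has an injective hull. -/
theorem exists_injective_hull (R : Type u) [CommRing R] (M : Type u) [AddCommGroup M]
    [Module R M] : ∃ (E : Type u) (_ : AddCommGroup E) (_ : Module R E) (ι : M →ₗ[R] E),
      Module.Injective R E ∧ Function.Injective ι ∧
        ∀ x : E, x ≠ 0 → ∃ (r : R) (m : M), r • x = ι m ∧ r • x ≠ 0 := by
  obtain ⟨E, _, _, ι, hE, hι⟩ := exists_injective_extension R M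
  obtain ⟨F, hF, hF', hess⟩ := exists_injective_essential_submodule hE (LinearMap.range ι)
  refine ⟨F, inferInstance, inferInstance, ι.codRestrict F fun m => hF ⟨m, rfl⟩, hF',
    fun m m' h => hι (congr_arg Subtype.val h), fun x hx => ?_⟩
  obtain ⟨r, ⟨m, hm⟩, hr⟩ := hess x x.2 (by simpa using hx)
  exact ⟨r, m, Subtype.ext hm.symm, fun h => hr (congr_arg Subtype.val h)⟩

/-- In an injective module, `s` divides everything that `(0 : s)` annihilates: `s ↦ x` defines a
map on the ideal generated by `s`. -/
theorem Module.Injective.exists_smul_eq {R : Type u} [CommRing R] {E : Type u}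
    [AddCommGroup E] [Module R E] (hE : Module.Injective R E) {s : R} {x : E}
    (h : ∀ a, s * a = 0 → a • x = 0) : ∃ y : E, x = s • y := by
  let μ : R →ₗ[R] R := LinearMap.toSpanSingleton R R s
  have hμ : LinearMap.ker μ ≤ LinearMap.ker (LinearMap.toSpanSingleton R E x) := fun a ha => by
    have ha' : a * s = 0 := ha
    exact h a (by rwa [mul_comm])
  obtain ⟨g, hg⟩ := hE.out ((LinearMap.ker μ).liftQ μ le_rfl)
    (LinearMap.ker_eq_bot.1 (Submodule.ker_liftQ_eq_bot' _ _ rfl))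
    ((LinearMap.ker μ).liftQ (LinearMap.toSpanSingleton R E x) hμ)
  refine ⟨g 1, ?_⟩
  have h1 : g (μ 1) = (1 : R) • x := hg (Submodule.Quotient.mk 1)
  rw [← map_smul, ← one_smul R x, ← h1]
  simp [μ]

/-! ### Characterization of IF chain rings -/

namespace IsChainRing

variable {R : Type u} [CommRing R] (hR : IsChainRing R)
include hR

/-- If injective modules are flat, then so is an injective module containing `R/rR`, and flatness
applied to the generator of `R/rR` displays `rR` as an annihilator. -/
theorem principalIdealsAreAnnihilators (h : IsIFRing R) : PrincipalIdealsAreAnnihilators R := by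
  intro r
  obtain ⟨E, _, _, ι, hE, hι⟩ := exists_injective_extension R (R ⧸ Ideal.span {r})
  have hmk (a : R) : a • ι (Submodule.Quotient.mk 1) = 0 ↔ r ∣ a := by
    rw [← map_smul, map_eq_zero_iff ι hι, ← Submodule.Quotient.mk_smul,
      Submodule.Quotient.mk_eq_zero, smul_eq_mul, mul_one, Ideal.mem_span_singleton]
  obtain ⟨s, y, hrs, hy⟩ := hR.flat_iff.1 (h E hE) r _ ((hmk r).2 dvd_rfl)
  refine ⟨s, fun a => ⟨fun ha => (hmk a).1 ?_, ?_⟩⟩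
  · rw [hy, smul_smul, mul_comm, ha, zero_smul]
  · rintro ⟨b, rfl⟩
    linear_combination b * hrs

theorem isIFRing (h : PrincipalIdealsAreAnnihilators R) : IsIFRing R := by
  intro E _ _ hE
  rw [hR.flat_iff]
  intro r x hrx
  obtain ⟨s, hs⟩ := h r
  obtain ⟨y, hy⟩ := hE.exists_smul_eq (s := s) (x := x) fun a ha => by
    obtain ⟨b, rfl⟩ := (hs a).1 ha
    rw [mul_comm, mul_smul, hrx, smul_zero]
  exact ⟨s, y, by rw [mul_comm]; exact (hs r).2 dvd_rfl, hy⟩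

theorem isIFRing_iff : IsIFRing R ↔ PrincipalIdealsAreAnnihilators R :=
  ⟨hR.principalIdealsAreAnnihilators, hR.isIFRing⟩

/-- Over an IF chain ring, a flat submodule of a flat module is pure, so it has a flat quotient. -/
theorem flat_of_exact_of_principalIdealsAreAnnihilators (h : PrincipalIdealsAreAnnihilators R)
    {K F M : Type*} [AddCommGroup K] [Module R K] [AddCommGroup F] [Module R F] [AddCommGroup M]
    [Module R M] [hK : Module.Flat R K] [hF : Module.Flat R F] {f : K →ₗ[R] F} {g : F →ₗ[R] M}
    (hf : Function.Injective f) (hfg : Function.Exact f g) (hg : Function.Surjective g) :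
    Module.Flat R M := by
  rw [hR.flat_iff] at hK hF ⊢
  intro r x hrx
  obtain ⟨x, rfl⟩ := hg x
  rw [← map_smul] at hrx
  obtain ⟨k, hk⟩ := (hfg _).1 hrx
  obtain ⟨s, hs⟩ := h r
  have hsr : s * r = 0 := (hs r).2 dvd_rfl
  obtain ⟨w, k', hsw, rfl⟩ := hK s k (hf (by
    rw [map_smul, hk, smul_smul, hsr, zero_smul, map_zero]))
  obtain ⟨b, rfl⟩ := (hs w).1 hsw
  have h0 : r • (x - b • f k') = 0 := by
    rw [smul_sub, smul_smul, ← map_smul, hk, sub_self]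
  obtain ⟨v, y, hrv, hy⟩ := hF _ _ h0
  refine ⟨v, g y, hrv, ?_⟩
  rw [← map_smul, ← hy, map_sub, map_smul, hfg.apply_apply_eq_zero, smul_zero, sub_zero]

end IsChainRing

/-! ### Semicoherent rings -/

namespace IsChainRing

variable {R : Type u} [CommRing R] [Nontrivial R] (hR : IsChainRing R)
include hR

/-- If finitely generated ideals of the total ring of fractions are annihilators, then a module which
is torsion-free for the regular elements has a flat injective hull. -/
theorem exists_flat_extension (h : FracIdealsAreAnnihilators R) {H : Type u} [AddCommGroup H]
    [Module R H] (hH : ∀ q ∉ zeroDivisorIdeal R hR, ∀ x : H, q • x = 0 → x = 0) :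
    ∃ (G : Type u) (_ : AddCommGroup G) (_ : Module R G),
      Module.Flat R G ∧ ∃ f : H →ₗ[R] G, Function.Injective f := by
  obtain ⟨E, _, _, ι, hE, hι, hess⟩ := exists_injective_hull R H
  refine ⟨E, inferInstance, inferInstance, hR.flat_iff.2 fun r x hrx => ?_, ι, hι⟩
  -- the injective hull of a torsion-free module is torsion-free
  have htf : ∀ q ∉ zeroDivisorIdeal R hR, ∀ x : E, q • x = 0 → x = 0 := by
    intro q hq x hqx
    by_contra hx
    obtain ⟨a, m, hm, ha⟩ := hess x hx
    refine ha (hm.trans ?_)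
    rw [hH q hq m (hι ?_), map_zero]
    rw [map_smul, ← hm, smul_comm, hqx, smul_zero, map_zero]
  obtain ⟨s, hs⟩ := h r
  obtain ⟨y, hy⟩ := hE.exists_smul_eq (s := s) (x := x) fun a ha => by
    obtain ⟨q, hq, k, hk⟩ := hR.fracDvd_iff.1 ((hs a).1 ha)
    refine htf q hq _ ?_
    rw [smul_smul, hk, mul_comm, mul_smul, hrx, smul_zero]
  exact ⟨s, y, by rw [mul_comm]; exact (hs r).2 (FracDvd.of_dvd dvd_rfl), hy⟩

theorem isSemicoherentRing (h : FracIdealsAreAnnihilators R) : IsSemicoherentRing R := by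
  intro E F _ _ _ _ hE _
  refine hR.exists_flat_extension h fun q hq φ hφ => LinearMap.ext fun e => ?_
  -- `E` is divisible by regular elements
  obtain ⟨e, rfl⟩ := hE.exists_smul_eq (s := q) (x := e) fun a ha => by
    rw [hR.eq_zero_of_mul_eq_zero hq ha, zero_smul]
  rw [map_smul, ← LinearMap.smul_apply, hφ, LinearMap.zero_apply, LinearMap.zero_apply]

/-- For `R ⊆ E` injective and `r` a nonzero zero divisor, the map `E → E/rE` has annihilator
`(0 : (0 : r))`. If it were an element of a flat module, this annihilator would contain `(0 : s)`
for some `s ∈ (0 : r)`, so `(0 : r)` would have the same annihilator as `s`. -/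
theorem not_isSemicoherentRing (h : AnnihilatorsAreZDivisible R hR) : ¬ IsSemicoherentRing R := by
  intro hsc
  obtain ⟨hZ, h⟩ := h
  obtain ⟨r, ⟨d, hd, hrd⟩, hr⟩ := Submodule.exists_mem_ne_zero_of_ne_bot hZ
  obtain ⟨E, _, _, ι, hE, hι⟩ := exists_injective_extension R R
  let N := LinearMap.range (LinearMap.lsmul R E r)
  obtain ⟨F, _, _, j, hF, hj⟩ := exists_injective_extension R (E ⧸ N)
  obtain ⟨G, _, _, hG, f, hf⟩ := hsc E F hE hF
  have hφ (v : R) (hv : v • (j ∘ₗ N.mkQ) = 0) (a : R) (ha : r * a = 0) : a * v = 0 := by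
    have h1 : j (N.mkQ (v • ι 1)) = 0 := by
      rw [map_smul, map_smul]
      exact LinearMap.congr_fun hv (ι 1)
    rw [map_eq_zero_iff j hj] at h1
    obtain ⟨e, he⟩ := (Submodule.Quotient.mk_eq_zero N).1 h1
    have he' : r • e = v • ι 1 := he
    apply hι
    rw [map_zero, ← mul_one (a * v), ← smul_eq_mul, map_smul, mul_smul, ← he', smul_smul,
      mul_comm, ha, zero_smul]
  have hrφ : r • (j ∘ₗ N.mkQ) = 0 := LinearMap.ext fun e => by
    have : N.mkQ (r • e) = 0 := (Submodule.Quotient.mk_eq_zero N).2 ⟨e, rfl⟩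
    rw [LinearMap.smul_apply, ← map_smul, LinearMap.comp_apply, this, map_zero,
      LinearMap.zero_apply]
  obtain ⟨s, y, hrs, hy⟩ := hR.flat_iff.1 hG r (f (j ∘ₗ N.mkQ)) (by
    rw [← map_smul, hrφ, map_zero])
  have hs (v : R) (hv : s * v = 0) : v • (j ∘ₗ N.mkQ) = 0 := hf (by
    rw [map_smul, hy, smul_smul, mul_comm, hv, zero_smul, map_zero])
  have hs0 : s ≠ 0 := by
    rintro rfl
    exact hd (by simpa using hφ 1 (hs 1 (zero_mul _)) d hrd)
  obtain ⟨b, c, hc, hsb, rfl⟩ := h s hs0 r (by rw [mul_comm, hrs])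
  obtain ⟨w, hw, hw'⟩ := hR.exists_mul_eq_zero_of_mem hc (left_ne_zero_of_mul hr)
  exact hw' (by rw [mul_comm]; exact hφ b (hs b hsb) w hw)

theorem isSemicoherentRing_iff : IsSemicoherentRing R ↔ FracIdealsAreAnnihilators R :=
  ⟨fun h => hR.fracIdealsAreAnnihilators_or.resolve_right fun h' =>
    hR.not_isSemicoherentRing h' h, hR.isSemicoherentRing⟩

/-- Over a semicoherent chain ring, a submodule `M` of a flat module `G` is flat if it has weak
dimension at most one. -/
theorem flat_of_exact_of_le_flat (h : FracIdealsAreAnnihilators R) {K F M G : Type*}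
    [AddCommGroup K] [Module R K] [AddCommGroup F] [Module R F] [AddCommGroup M] [Module R M]
    [AddCommGroup G] [Module R G] [hK : Module.Flat R K] [hF : Module.Flat R F]
    [hG : Module.Flat R G] {f : K →ₗ[R] F} {g : F →ₗ[R] M} {i : M →ₗ[R] G}
    (hf : Function.Injective f) (hfg : Function.Exact f g) (hg : Function.Surjective g)
    (hi : Function.Injective i) : Module.Flat R M := by
  have htf (q : R) (hq : q ∉ zeroDivisorIdeal R hR) (x : M) (hx : q • x = 0) : x = 0 := by
    refine hi ((hR.isSMulRegular_of_flat (M := G) hq) ?_)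
    change q • i x = q • i 0
    rw [← map_smul, hx, map_zero, smul_zero]
  rw [hR.flat_iff] at hK hF ⊢
  intro r x hrx
  by_cases hr : r = 0
  · exact ⟨1, x, by rw [hr, zero_mul], (one_smul R x).symm⟩
  obtain ⟨y, rfl⟩ := hg x
  rw [← map_smul] at hrx
  obtain ⟨k, hk⟩ := (hfg _).1 hrx
  -- `(0 : s) = rQ ∩ R`
  obtain ⟨s, hs⟩ := h r
  have hsr : s * r = 0 := (hs r).2 (FracDvd.of_dvd dvd_rfl)
  obtain ⟨w, k', hsw, rfl⟩ := hK s k (hf (by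
    rw [map_smul, hk, smul_smul, hsr, zero_smul, map_zero]))
  obtain ⟨q, hq, b, hb⟩ := hR.fracDvd_iff.1 ((hs w).1 hsw)
  have h0 : r • (q • y - b • f k') = 0 := by
    rw [smul_sub, smul_comm, ← hk, map_smul, smul_smul, smul_smul, hb, sub_self]
  obtain ⟨d, z, hrd, hz⟩ := hF _ _ h0
  have hd : d ∈ zeroDivisorIdeal R hR := ⟨r, hr, by rw [mul_comm, hrd]⟩
  obtain ⟨d, -, rfl⟩ := hR.exists_mul_eq_of_notMem hq hd
  refine ⟨d, g z, hR.eq_zero_of_mul_eq_zero hq (by linear_combination hrd), ?_⟩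
  rw [← sub_eq_zero]
  refine htf q hq _ ?_
  have := congr_arg g hz
  rw [map_sub, map_smul, map_smul, map_smul, hfg.apply_apply_eq_zero, smul_zero, sub_zero,
    mul_smul] at this
  rw [smul_sub, this, sub_self]

end IsChainRing

/-! ### Rings that are not semicoherent -/

namespace IsChainRing

variable {R : Type u} [CommRing R] (hR : IsChainRing R)
include hR

theorem flat_of_exact_of_flat {A B C : Type*} [AddCommGroup A] [Module R A] [AddCommGroup B]
    [Module R B] [AddCommGroup C] [Module R C] [hB : Module.Flat R B] [hC : Module.Flat R C]
    {f : A →ₗ[R] B} {g : B →ₗ[R] C} (hf : Function.Injective f) (hfg : Function.Exact f g)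
    (hg : Function.Surjective g) : Module.Flat R A := by
  rw [hR.flat_iff] at hB hC ⊢
  intro r x hrx
  obtain ⟨s, b, hrs, hb⟩ := hB r (f x) (by rw [← map_smul, hrx, map_zero])
  obtain ⟨w, c, hsw, hc⟩ := hC s (g b) (by rw [← map_smul, ← hb, hfg.apply_apply_eq_zero])
  obtain ⟨c, rfl⟩ := hg c
  obtain ⟨y, hy⟩ := (hfg (b - w • c)).1 (by rw [map_sub, map_smul, hc, sub_self])
  refine ⟨s, y, hrs, hf ?_⟩
  rw [hb, map_smul, hy, smul_sub, smul_smul, hsw, zero_smul, sub_zero]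

/-- The kernel of `I ⊗ K → K` is a `Tor₁`, and it vanishes for a submodule `K` of a flat module
if `I` is flat. -/
theorem lift_lsmul_injective_of_le_flat {I : Ideal R} [Module.Flat R I] {K F : Type*}
    [AddCommGroup K] [Module R K] [AddCommGroup F] [Module R F] [hF : Module.Flat R F]
    {f : K →ₗ[R] F} (hf : Function.Injective f) :
    Function.Injective (TensorProduct.lift ((LinearMap.lsmul R K).comp I.subtype)) := by
  rw [injective_iff_map_eq_zero]
  intro ξ hξ
  refine Module.Flat.lTensor_preserves_injective_linearMap (M := I) f hf ?_
  obtain ⟨a, x, rfl⟩ := hR.exists_eq_tmul ξ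
  have hax : (a : R) • x = 0 := by simpa using hξ
  obtain ⟨s, y, hs, hy⟩ := hR.flat_iff.1 hF a (f x) (by rw [← map_smul, hax, map_zero])
  rw [map_zero, LinearMap.lTensor_tmul, hy, ← TensorProduct.smul_tmul,
    show s • a = 0 from Subtype.ext ((mul_comm _ _).trans hs), TensorProduct.zero_tmul]

variable [Nontrivial R]

/-- In the non-semicoherent case, `Z = Z²`, even on single elements. -/
theorem exists_mul_eq_of_mem (h : AnnihilatorsAreZDivisible R hR) {z : R}
    (hz : z ∈ zeroDivisorIdeal R hR) :
    ∃ b ∈ zeroDivisorIdeal R hR, ∃ c ∈ zeroDivisorIdeal R hR, z = b * c := by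
  obtain ⟨d, hd, hzd⟩ := hz
  obtain ⟨b, c, hc, hdb, rfl⟩ := h.2 d hd z (by rw [mul_comm, hzd])
  exact ⟨b, ⟨d, hd, by rw [mul_comm, hdb]⟩, c, hc, rfl⟩

theorem flat_zeroDivisorIdeal (h : AnnihilatorsAreZDivisible R hR) :
    Module.Flat R (zeroDivisorIdeal R hR) := by
  rw [hR.flat_iff]
  intro r z hrz
  by_cases hr : r = 0
  · exact ⟨1, z, by rw [hr, zero_mul], (one_smul R z).symm⟩
  obtain ⟨b, c, hc, hrb, hz⟩ := h.2 r hr z (congr_arg Subtype.val hrz)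
  exact ⟨b, ⟨c, hc⟩, hrb, Subtype.ext hz⟩

/-- Elementwise form of: if `Tor₁(R/Z, K) = 0` and `Z ⊗ K` is flat, then `K` has weak dimension
at most one. -/
theorem flat_of_flat_tensor_zeroDivisorIdeal (h : AnnihilatorsAreZDivisible R hR)
    {A F K : Type*} [AddCommGroup A] [Module R A] [AddCommGroup F] [Module R F]
    [AddCommGroup K] [Module R K] [hF : Module.Flat R F]
    [hK : Module.Flat R (TensorProduct R (zeroDivisorIdeal R hR) K)]
    {f : A →ₗ[R] F} {g : F →ₗ[R] K} (hf : Function.Injective f) (hfg : Function.Exact f g)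
    (hg : Function.Surjective g)
    (hinj : Function.Injective (TensorProduct.lift
      ((LinearMap.lsmul R K).comp (zeroDivisorIdeal R hR).subtype))) : Module.Flat R A := by
  rw [hR.flat_iff] at hF hK ⊢
  intro r x hrx
  by_cases hr : r = 0
  · exact ⟨1, x, by rw [hr, zero_mul], (one_smul R x).symm⟩
  obtain ⟨s, y, hrs, hy⟩ := hF r (f x) (by rw [← map_smul, hrx, map_zero])
  -- `s = b c` with `c ∈ Z`; correct `c y` by an element that `b` annihilates to land in `A`
  obtain ⟨b, c, hc, hrb, rfl⟩ := h.2 r hr s hrs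
  obtain ⟨w, ξ, hbw, hξ⟩ := hK b (⟨c, hc⟩ ⊗ₜ g y) (hinj (by
    rw [map_smul, map_zero, TensorProduct.lift.tmul]
    change b • c • g y = 0
    rw [smul_smul, ← map_smul, ← hy, hfg.apply_apply_eq_zero]))
  obtain ⟨k, hk⟩ := hg (TensorProduct.lift
    ((LinearMap.lsmul R K).comp (zeroDivisorIdeal R hR).subtype) ξ)
  have hwk : g (c • y) = g (w • k) := by
    rw [map_smul g w, hk, ← map_smul, ← hξ, map_smul]
    rfl
  obtain ⟨a, ha⟩ := (hfg (c • y - w • k)).1 (by rw [map_sub, hwk, sub_self])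
  refine ⟨b, a, hrb, hf ?_⟩
  rw [hy, map_smul, ha, smul_sub, smul_smul, smul_smul, hbw, zero_smul, sub_zero]

/-- Flatness of `Z ⊗ -` passes from a syzygy to the module. By induction, it holds for every module
of finite weak dimension. -/
theorem flat_tensor_zeroDivisorIdeal_of_exact (h : AnnihilatorsAreZDivisible R hR)
    {K F M : Type*} [AddCommGroup K] [Module R K] [AddCommGroup F] [Module R F]
    [AddCommGroup M] [Module R M] [Module.Flat R F]
    [hK : Module.Flat R (TensorProduct R (zeroDivisorIdeal R hR) K)]
    {f : K →ₗ[R] F} {g : F →ₗ[R] M} (hf : Function.Injective f) (hfg : Function.Exact f g)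
    (hg : Function.Surjective g) :
    Module.Flat R (TensorProduct R (zeroDivisorIdeal R hR) M) := by
  have hZ := hR.flat_zeroDivisorIdeal h
  have hF : Module.Flat R (TensorProduct R (zeroDivisorIdeal R hR) F) := inferInstance
  have hfZ := Module.Flat.lTensor_preserves_injective_linearMap (M := zeroDivisorIdeal R hR) f hf
  have hfgZ := Module.Flat.lTensor_exact (zeroDivisorIdeal R hR) hfg
  have hgZ := LinearMap.lTensor_surjective (zeroDivisorIdeal R hR) hg
  rw [hR.flat_iff] at hF hK ⊢
  intro r x hrx
  obtain ⟨x, rfl⟩ := hgZ x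
  by_cases hr : r = 0
  · exact ⟨1, _, by rw [hr, zero_mul], (one_smul R _).symm⟩
  rw [← map_smul] at hrx
  obtain ⟨κ, hκ⟩ := (hfgZ _).1 hrx
  suffices ∃ κ', κ = r • κ' by
    obtain ⟨κ', rfl⟩ := this
    obtain ⟨s, y, hrs, hy⟩ := hF r (x - f.lTensor _ κ') (by
      rw [smul_sub, ← map_smul, hκ, sub_self])
    refine ⟨s, g.lTensor _ y, hrs, ?_⟩
    rw [← map_smul, ← hy, map_sub, hfgZ.apply_apply_eq_zero, sub_zero]
  by_cases hrZ : r ∈ zeroDivisorIdeal R hR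
  · -- write `x = b • y` with `b ∈ Z`; choose `a` with `a r b = 0` and `a r ≠ 0`, so that `a`
    -- annihilates `κ` and `(0 : a) ⊆ r R`
    obtain ⟨⟨z, hz⟩, y, rfl⟩ := hR.exists_eq_tmul x
    obtain ⟨b, hb, c, hc, rfl⟩ := hR.exists_mul_eq_of_mem h hz
    obtain ⟨a, ha, ha'⟩ := hR.exists_mul_eq_zero_of_mem hb hr
    obtain ⟨w, κ', haw, rfl⟩ := hK a κ (hfZ (by
      rw [map_smul, hκ, map_zero, smul_smul, TensorProduct.smul_tmul',
        show (a * r) • (⟨b * c, hz⟩ : zeroDivisorIdeal R hR) = 0 from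
          Subtype.ext (by change a * r * (b * c) = 0; linear_combination c * ha),
        TensorProduct.zero_tmul]))
    rcases hR.dvd_or_dvd r w with ⟨v, rfl⟩ | ⟨v, rfl⟩
    · exact ⟨v • κ', mul_smul _ _ _⟩
    · exact absurd (by linear_combination v * haw) ha'
  · obtain ⟨z, k, rfl⟩ := hR.exists_eq_tmul κ
    obtain ⟨z', hz', hz⟩ := hR.exists_mul_eq_of_notMem hrZ z.2
    exact ⟨⟨z', hz'⟩ ⊗ₜ k, by rw [TensorProduct.smul_tmul']; congr 1; exact Subtype.ext hz⟩

theorem flat_tensor_of_hasWeakDimensionLE (h : AnnihilatorsAreZDivisible R hR) (n : ℕ) :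
    ∀ (M : Type u) [AddCommGroup M] [Module R M], HasWeakDimensionLE R M n →
      Module.Flat R (TensorProduct R (zeroDivisorIdeal R hR) M) := by
  have hZ := hR.flat_zeroDivisorIdeal h
  induction n with
  | zero =>
    intro M _ _ hM
    have := hasWeakDimensionLE_zero_iff.1 hM
    infer_instance
  | succ n ih =>
    intro M _ _ hM
    obtain ⟨F, _, _, _, K, g, hg, hg'⟩ := exists_flat_presentation R M
    have := ih K ((hasWeakDimensionLE_succ_iff K.injective_subtype hg hg' n).1 hM)
    exact hR.flat_tensor_zeroDivisorIdeal_of_exact h K.injective_subtype hg hg'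

theorem hasWeakDimensionLE_two_of_flat_tensor (h : AnnihilatorsAreZDivisible R hR)
    (M : Type u) [AddCommGroup M] [Module R M]
    [Module.Flat R (TensorProduct R (zeroDivisorIdeal R hR) M)] : HasWeakDimensionLE R M 2 := by
  have hZ := hR.flat_zeroDivisorIdeal h
  obtain ⟨F, _, _, _, K, g, hg, hg'⟩ := exists_flat_presentation R M
  obtain ⟨F', _, _, _, K', g', hk, hk'⟩ := exists_flat_presentation R K
  rw [hasWeakDimensionLE_succ_iff K.injective_subtype hg hg',
    hasWeakDimensionLE_succ_iff K'.injective_subtype hk hk', hasWeakDimensionLE_zero_iff]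
  have : Module.Flat R (TensorProduct R (zeroDivisorIdeal R hR) K) :=
    hR.flat_of_exact_of_flat
      (Module.Flat.lTensor_preserves_injective_linearMap (M := zeroDivisorIdeal R hR) _
        K.injective_subtype)
      (Module.Flat.lTensor_exact (zeroDivisorIdeal R hR) hg)
      (LinearMap.lTensor_surjective (zeroDivisorIdeal R hR) hg')
  exact hR.flat_of_flat_tensor_zeroDivisorIdeal h K'.injective_subtype hk hk'
    (hR.lift_lsmul_injective_of_le_flat K.injective_subtype)

/-- The injective hull of `R/Z` is flat. Its nonzero elements have annihilators of the form `tZ`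
with `t ≠ 0`, and each `tz` with `z ∈ Z` lies in some `(0 : s) ⊆ tZ`. -/
theorem exists_flat_extension_quotient :
    ∃ (E : Type u) (_ : AddCommGroup E) (_ : Module R E)
      (ι : (R ⧸ zeroDivisorIdeal R hR) →ₗ[R] E),
      Module.Flat R E ∧ Function.Injective ι := by
  obtain ⟨E, _, _, ι, hE, hι, hess⟩ := exists_injective_hull R (R ⧸ zeroDivisorIdeal R hR)
  refine ⟨E, inferInstance, inferInstance, ι, hR.flat_iff.2 fun r x hrx => ?_, hι⟩
  by_cases hx : x = 0
  · exact ⟨0, 0, mul_zero r, by rw [hx, smul_zero]⟩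
  obtain ⟨t, m, hm, htx⟩ := hess x hx
  obtain ⟨q, rfl⟩ := Submodule.Quotient.mk_surjective _ m
  -- the annihilator of `t • x` is `Z`
  have hann (a : R) : (a * t) • x = 0 ↔ a ∈ zeroDivisorIdeal R hR := by
    have hq : q ∉ zeroDivisorIdeal R hR := fun hq => htx (by
      rw [hm, (Submodule.Quotient.mk_eq_zero _).2 hq, map_zero])
    rw [mul_smul, hm, ← map_smul, map_eq_zero_iff ι hι, ← Submodule.Quotient.mk_smul,
      Submodule.Quotient.mk_eq_zero, smul_eq_mul]
    exact ⟨fun haq => by_contra fun ha => hR.mul_notMem ha hq haq,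
      fun ha => Ideal.mul_mem_right q _ ha⟩
  have ht : t ≠ 0 := by
    rintro rfl
    exact htx (zero_smul R x)
  obtain ⟨z, hz, rfl⟩ : ∃ z ∈ zeroDivisorIdeal R hR, r = t * z := by
    rcases hR.dvd_or_dvd t r with ⟨z, rfl⟩ | ⟨c, rfl⟩
    · exact ⟨z, (hann z).1 (by rw [mul_comm, hrx]), rfl⟩
    · exact absurd (by rw [mul_comm, mul_smul, hrx, smul_zero]) htx
  obtain ⟨s, hs, hs'⟩ := hR.exists_mul_eq_zero_of_mem hz ht
  obtain ⟨y, hy⟩ := hE.exists_smul_eq (s := s) (x := x) fun a ha => by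
    rcases hR.dvd_or_dvd t a with ⟨c, rfl⟩ | ⟨c, rfl⟩
    · rw [mul_comm, hann]
      exact ⟨t * s, hs', by linear_combination ha⟩
    · exact absurd (by linear_combination c * ha) hs'
  exact ⟨s, y, hs, hy⟩

theorem not_flat_quotient (h : zeroDivisorIdeal R hR ≠ ⊥) :
    ¬ Module.Flat R (R ⧸ zeroDivisorIdeal R hR) := by
  intro hflat
  obtain ⟨z, hz, hz0⟩ := Submodule.exists_mem_ne_zero_of_ne_bot h
  obtain ⟨s, y, hzs, hy⟩ := hR.flat_iff.1 hflat z (Submodule.Quotient.mk 1) (by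
    rw [← Submodule.Quotient.mk_smul, Submodule.Quotient.mk_eq_zero, smul_eq_mul, mul_one]
    exact hz)
  obtain ⟨y, rfl⟩ := Submodule.Quotient.mk_surjective _ y
  rw [← Submodule.Quotient.mk_smul, Submodule.Quotient.eq, smul_eq_mul] at hy
  have hs : s ∈ zeroDivisorIdeal R hR := ⟨z, hz0, by rw [mul_comm, hzs]⟩
  obtain ⟨b, hb, hb'⟩ : (1 : R) ∈ zeroDivisorIdeal R hR := by
    simpa using add_mem hy (Ideal.mul_mem_right y _ hs)
  exact hb (by simpa using hb')

/-- The cokernel of an embedding of `R/Z` into a flat module has weak dimension exactly two. -/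
theorem two_le_finitisticWeakDimension (h : AnnihilatorsAreZDivisible R hR) :
    ((2 : ℕ) : ℕ∞) ≤ finitisticWeakDimension R := by
  have hZ := hR.flat_zeroDivisorIdeal h
  obtain ⟨E, _, _, ι, _, hι⟩ := hR.exists_flat_extension_quotient
  have hex := LinearMap.exact_map_mkQ_range ι
  have hsurj := (LinearMap.range ι).mkQ_surjective
  refine le_finitisticWeakDimension (M := E ⧸ LinearMap.range ι) ?_ ?_
  · rw [hasWeakDimensionLE_succ_iff hι hex hsurj, hasWeakDimensionLE_succ_iff
      (zeroDivisorIdeal R hR).injective_subtype (LinearMap.exact_subtype_mkQ _)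
      (Submodule.mkQ_surjective _), hasWeakDimensionLE_zero_iff]
    exact hZ
  · rw [hasWeakDimensionLE_succ_iff hι hex hsurj, hasWeakDimensionLE_zero_iff]
    exact hR.not_flat_quotient h.1

end IsChainRing

/-! ### The finitistic weak dimension of IF and of semicoherent rings -/

namespace IsChainRing

variable {R : Type u} [CommRing R] (hR : IsChainRing R)
include hR

theorem finitisticWeakDimension_eq_zero (h : PrincipalIdealsAreAnnihilators R) :
    finitisticWeakDimension R = 0 := by
  suffices ∀ (n : ℕ) (M : Type u) [AddCommGroup M] [Module R M], HasWeakDimensionLE R M n →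
      HasWeakDimensionLE R M 0 from
    nonpos_iff_eq_zero.1 (finitisticWeakDimension_le fun M _ _ n => this n M)
  intro n
  induction n with
  | zero => exact fun M _ _ hM => hM
  | succ n ih =>
    intro M _ _ hM
    obtain ⟨F, _, _, _, K, g, hg, hg'⟩ := exists_flat_presentation R M
    have := hasWeakDimensionLE_zero_iff.1
      (ih K ((hasWeakDimensionLE_succ_iff K.injective_subtype hg hg' n).1 hM))
    exact hasWeakDimensionLE_zero_iff.2
      (hR.flat_of_exact_of_principalIdealsAreAnnihilators h K.injective_subtype hg hg')

variable [Nontrivial R]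

/-- If `t` is a regular nonunit, then `R/tR` has weak dimension one. -/
theorem one_le_finitisticWeakDimension {t : R} (ht : t ∉ zeroDivisorIdeal R hR)
    (ht' : ¬ IsUnit t) : ((1 : ℕ) : ℕ∞) ≤ finitisticWeakDimension R := by
  let f : R →ₗ[R] R := LinearMap.lsmul R R t
  have hf : Function.Injective f := by
    rw [injective_iff_map_eq_zero]
    exact fun x hx => hR.eq_zero_of_mul_eq_zero ht hx
  have hex := LinearMap.exact_map_mkQ_range f
  have hsurj := (LinearMap.range f).mkQ_surjective
  refine le_finitisticWeakDimension (M := R ⧸ LinearMap.range f) (d := 0) ?_ ?_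
  · rw [hasWeakDimensionLE_succ_iff hf hex hsurj, hasWeakDimensionLE_zero_iff]
    infer_instance
  · rw [hasWeakDimensionLE_zero_iff]
    intro hflat
    have h1 : (Submodule.Quotient.mk 1 : R ⧸ LinearMap.range f) = 0 :=
      hR.isSMulRegular_of_flat ht (by
        change t • (Submodule.Quotient.mk 1 : R ⧸ LinearMap.range f) = t • 0
        rw [smul_zero, ← Submodule.Quotient.mk_smul, Submodule.Quotient.mk_eq_zero]
        exact ⟨1, rfl⟩)
    obtain ⟨u, hu⟩ := (Submodule.Quotient.mk_eq_zero _).1 h1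
    exact ht' (IsUnit.of_mul_eq_one u hu)

theorem finitisticWeakDimension_eq_one (h : FracIdealsAreAnnihilators R)
    (h' : ¬ PrincipalIdealsAreAnnihilators R) : finitisticWeakDimension R = 1 := by
  refine le_antisymm (finitisticWeakDimension_le (d := 1) fun M _ _ n hM => ?_) ?_
  · suffices ∀ (n : ℕ) (M : Type u) [AddCommGroup M] [Module R M],
        HasWeakDimensionLE R M (n + 1) → HasWeakDimensionLE R M 1 from this n M hM.succ
    intro n
    induction n with
    | zero => exact fun M _ _ hM => hM
    | succ n ih =>
      intro M _ _ hM
      obtain ⟨F, _, _, _, K, g, hg, hg'⟩ := exists_flat_presentation R M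
      obtain ⟨F', _, _, _, K', g', hk, hk'⟩ := exists_flat_presentation R K
      rw [hasWeakDimensionLE_succ_iff K.injective_subtype hg hg'] at hM ⊢
      have := hasWeakDimensionLE_zero_iff.1
        ((hasWeakDimensionLE_succ_iff K'.injective_subtype hk hk' 0).1 (ih K hM))
      exact hasWeakDimensionLE_zero_iff.2
        (hR.flat_of_exact_of_le_flat h K'.injective_subtype hk hk' K.injective_subtype)
  · obtain ⟨t, ht, ht'⟩ : ∃ t ∉ zeroDivisorIdeal R hR, ¬ IsUnit t := by
      by_contra! hunit
      refine h' fun r => (h r).imp fun s hs a => (hs a).trans ?_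
      refine ⟨fun hra => ?_, FracDvd.of_dvd⟩
      obtain ⟨q, hq, hra⟩ := hR.fracDvd_iff.1 hra
      exact (hunit q hq).dvd_mul_left.1 hra
    exact hR.one_le_finitisticWeakDimension ht ht'

end IsChainRing

theorem theorem2 (R : Type u) [CommRing R] [Nontrivial R] (hR : IsChainRing R) :
    (IsIFRing R → finitisticWeakDimension R = 0) ∧
    (IsSemicoherentRing R → ¬ IsIFRing R → finitisticWeakDimension R = 1) ∧
    (¬ IsSemicoherentRing R →
      finitisticWeakDimension R = 2 ∧
      ∀ (M : Type u) [AddCommGroup M] [Module R M],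
        weakDimension R M < ⊤ ↔
          Module.Flat R (TensorProduct R (zeroDivisorIdeal R hR) M)) := by
  rw [hR.isIFRing_iff, hR.isSemicoherentRing_iff]
  refine ⟨hR.finitisticWeakDimension_eq_zero, hR.finitisticWeakDimension_eq_one, fun h => ?_⟩
  have hB := hR.fracIdealsAreAnnihilators_or.resolve_left h
  refine ⟨le_antisymm (finitisticWeakDimension_le (d := 2) fun M _ _ n hM => ?_)
    (hR.two_le_finitisticWeakDimension hB), fun M _ _ => ⟨fun hM => ?_, fun hM => ?_⟩⟩
  · have := hR.flat_tensor_of_hasWeakDimensionLE hB n M hM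
    exact hR.hasWeakDimensionLE_two_of_flat_tensor hB M
  · obtain ⟨n, hn⟩ := weakDimension_lt_top_iff.1 hM
    exact hR.flat_tensor_of_hasWeakDimensionLE hB n M hn
  · exact weakDimension_lt_top_iff.2 ⟨2, hR.hasWeakDimensionLE_two_of_flat_tensor hB M⟩
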